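/- Let $\mathcal{A}$ be a small abelian category in which every object has finite length, and let $\mathcal{B}\subseteq\mathcal{A}$ be the full subcategory of semisimple objects (finite direct sums of simple objects), which is again abelian with exact inclusion. For an abelian category $\mathcal{N}$, a binary short acyclic sequence in $\mathcal{N}$ is a diagram $$M' \overset{i}{\underset{j}{\rightrightarrows}} M \overset{p}{\underset{q}{\rightrightarrows}} M''$$ such that both the top sequence $0\to M'\xrightarrow{i} M\xrightarrow{p} M''\to 0$ and the bottom sequence $0\to M'\xrightarrow{j} M\xrightarrow{q} M''\to 0$ are exact. Nenashev's group $K_1(\mathcal{N})$ is the abelian group generated by the binary short acyclic sequences in $\mathcal{N}$ subject to the following relations. (1) A sequence with $i=j$ and $p=q$ is $0$. (2) Suppose given a $3\times 3$ diagram whose rows are, from top to bottom, binary short acyclic sequences $P', P, P''$ and whose columns are, from left to right, binary short acyclic sequences $C_2, C_1, C_0$, such that the top differentials of the rows commute with the top differentials of the columns and the bottom differentials of the rows commute with the bottom differentials of the columns. Then $C_0-C_1+C_2=P'-P+P''$. An exact functor induces a homomorphism on $K_1$; let $c\colon K_1(\mathcal{B})\to K_1(\mathcal{A})$ be the homomorphism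 induced by the inclusion. Let $M' \overset{i}{\underset{j}{\rightrightarrows}} M \overset{p}{\underset{q}{\rightrightarrows}} M''$ be a binary short acyclic sequence in $\mathcal{A}$, let $x\in K_1(\mathcal{A})$ be its class, and put $U:=i(M')\cap j(M')\subseteq M$. Then $x$ belongs to the image of $c$ in each of the following two cases. (A) $\mathrm{length}(M')\le 3$, and neither of the following two conditions holds: - $\mathrm{length}(M')=3$, $U$ is simple and $i^{-1}(U)\cap j^{-1}(U)=0$; - $\mathrm{length}(M')=3$ and $U=0$. (B) $\mathrm{length}(M'')\le 3$, and neither of the following two conditions holds: - $\mathrm{length}(M'')=3$, $M/(i(M')+j(M'))$ is simple and $M''/(pj(M')+qi(M'))=0$; - $\mathrm{length}(M'')=3$ and $M/(i(M')+j(M'))=0$. -/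

import Mathlib

open CategoryTheory CategoryTheory.Limits

/-! ### Binary short exact sequences and Nenashev's `K₁` -/

/-- A binary short acyclic sequence `X₂ ⇉ X₁ ⇉ X₀` in an abelian category (a binary acyclic complex
of length `2`): a top short exact sequence `0 → X₂ -i→ X₁ -p→ X₀ → 0` and a bottom short exact
sequence `0 → X₂ -j→ X₁ -q→ X₀ → 0` on the same three objects. -/
structure BinarySES {A : Type*} [Category* A] [Abelian A] (X₂ X₁ X₀ : A) where
  i : X₂ ⟶ X₁
  j : X₂ ⟶ X₁
  p : X₁ ⟶ X₀
  q : X₁ ⟶ X₀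
  zero_top : i ≫ p = 0
  zero_bot : j ≫ q = 0
  exact_top : (ShortComplex.mk i p zero_top).ShortExact
  exact_bot : (ShortComplex.mk j q zero_bot).ShortExact

namespace BinarySES

section

variable {A : Type*} [Category* A] [Abelian A] {X₂ X₁ X₀ : A}

/-- A binary complex is diagonal if its top and bottom differentials agree. -/
def IsDiagonal (s : BinarySES X₂ X₁ X₀) : Prop := s.i = s.j ∧ s.p = s.q

/-- The image of a binary short acyclic sequence under an exact functor. -/
def map {B : Type*} [Category* B] [Abelian B] (F : A ⥤ B) [F.Additive]
    [PreservesFiniteLimits F] [PreservesFiniteColimits F] (s : BinarySES X₂ X₁ X₀) :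
    BinarySES (F.obj X₂) (F.obj X₁) (F.obj X₀) where
  i := F.map s.i
  j := F.map s.j
  p := F.map s.p
  q := F.map s.q
  zero_top := by rw [← F.map_comp, s.zero_top, F.map_zero]
  zero_bot := by rw [← F.map_comp, s.zero_bot, F.map_zero]
  exact_top := s.exact_top.map_of_exact F
  exact_bot := s.exact_bot.map_of_exact F

end

end BinarySES

/-- A `3 × 3` diagram whose rows `P'`, `P`, `P''` (from top to bottom) and columns `C₂`, `C₁`, `C₀`
(from left to right) are binary short acyclic sequences, such that top differentials commute
with top differentials and bottom differentials commute with bottom differentials. -/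
structure NenashevDiagram (A : Type*) [Category* A] [Abelian A] where
  {X'₂ X'₁ X'₀ X₂ X₁ X₀ X''₂ X''₁ X''₀ : A}
  row' : BinarySES X'₂ X'₁ X'₀
  row : BinarySES X₂ X₁ X₀
  row'' : BinarySES X''₂ X''₁ X''₀
  col₂ : BinarySES X'₂ X₂ X''₂
  col₁ : BinarySES X'₁ X₁ X''₁
  col₀ : BinarySES X'₀ X₀ X''₀
  top_comm₁ : row'.i ≫ col₁.i = col₂.i ≫ row.i
  top_comm₂ : row'.p ≫ col₀.i = col₁.i ≫ row.p
  top_comm₃ : row.i ≫ col₁.p = col₂.p ≫ row''.i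
  top_comm₄ : row.p ≫ col₀.p = col₁.p ≫ row''.p
  bot_comm₁ : row'.j ≫ col₁.j = col₂.j ≫ row.j
  bot_comm₂ : row'.q ≫ col₀.j = col₁.j ≫ row.q
  bot_comm₃ : row.j ≫ col₁.q = col₂.q ≫ row''.j
  bot_comm₄ : row.q ≫ col₀.q = col₁.q ≫ row''.q

namespace NenashevDiagram

/-- The image of a `3 × 3` diagram under an exact functor. -/
def map {A : Type*} [Category* A] [Abelian A] {B : Type*} [Category* B] [Abelian B] (F : A ⥤ B)
    [F.Additive] [PreservesFiniteLimits F] [PreservesFiniteColimits F] (D : NenashevDiagram A) :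
    NenashevDiagram B where
  row' := D.row'.map F
  row := D.row.map F
  row'' := D.row''.map F
  col₂ := D.col₂.map F
  col₁ := D.col₁.map F
  col₀ := D.col₀.map F
  top_comm₁ := by simp only [BinarySES.map, ← F.map_comp, D.top_comm₁]
  top_comm₂ := by simp only [BinarySES.map, ← F.map_comp, D.top_comm₂]
  top_comm₃ := by simp only [BinarySES.map, ← F.map_comp, D.top_comm₃]
  top_comm₄ := by simp only [BinarySES.map, ← F.map_comp, D.top_comm₄]
  bot_comm₁ := by simp only [BinarySES.map, ← F.map_comp, D.bot_comm₁]
  bot_comm₂ := by simp only [BinarySES.map, ← F.map_comp, D.bot_comm₂]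
  bot_comm₃ := by simp only [BinarySES.map, ← F.map_comp, D.bot_comm₃]
  bot_comm₄ := by simp only [BinarySES.map, ← F.map_comp, D.bot_comm₄]

end NenashevDiagram

namespace NenashevK1

universe v u v' u'

/-- All binary short acyclic sequences in `A`, bundled with their objects. -/
abbrev Gen (A : Type u) [Category.{v} A] [Abelian A] : Type (max u v) :=
  Σ (X₂ X₁ X₀ : A), BinarySES X₂ X₁ X₀

/-- The generator given by a binary short acyclic sequence in the free abelian group. -/
def gen {A : Type u} [Category.{v} A] [Abelian A] {X₂ X₁ X₀ : A} (s : BinarySES X₂ X₁ X₀) :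
    FreeAbelianGroup (Gen A) :=
  FreeAbelianGroup.of ⟨X₂, X₁, X₀, s⟩

/-- The element `(C₀ - C₁ + C₂) - (P' - P + P'')` associated with a `3 × 3` diagram. -/
def diagramRelation {A : Type u} [Category.{v} A] [Abelian A] (D : NenashevDiagram A) :
    FreeAbelianGroup (Gen A) :=
  (gen D.col₀ - gen D.col₁ + gen D.col₂) - (gen D.row' - gen D.row + gen D.row'')

/-- Nenashev's relations: diagonal complexes, and `3 × 3` diagrams. -/
def relations (A : Type u) [Category.{v} A] [Abelian A] : Set (FreeAbelianGroup (Gen A)) :=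
  {r | ∃ (X₂ X₁ X₀ : A) (s : BinarySES X₂ X₁ X₀), s.IsDiagonal ∧ r = gen s} ∪
    {r | ∃ D : NenashevDiagram A, r = diagramRelation D}

/-- Nenashev's group `K₁(A)` of an abelian category `A` (with all short exact sequences). -/
def K1 (A : Type u) [Category.{v} A] [Abelian A] : Type (max u v) :=
  FreeAbelianGroup (Gen A) ⧸ AddSubgroup.closure (relations A)

instance (A : Type u) [Category.{v} A] [Abelian A] : AddCommGroup (K1 A) :=
  inferInstanceAs (AddCommGroup (FreeAbelianGroup (Gen A) ⧸ AddSubgroup.closure (relations A)))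

/-- The class in `K₁(A)` of a binary short acyclic sequence. -/
def cls {A : Type u} [Category.{v} A] [Abelian A] {X₂ X₁ X₀ : A} (s : BinarySES X₂ X₁ X₀) :
    K1 A :=
  QuotientAddGroup.mk' (AddSubgroup.closure (relations A)) (gen s)

/-- The homomorphism `K₁(A) → K₁(B)` induced by an exact functor; it sends the class of `s` to
the class of `F(s)`. -/
def map {A : Type u} [Category.{v} A] [Abelian A] {B : Type u'} [Category.{v'} B] [Abelian B]
    (F : A ⥤ B) [F.Additive] [PreservesFiniteLimits F] [PreservesFiniteColimits F] :
    K1 A →+ K1 B :=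
  QuotientAddGroup.map (AddSubgroup.closure (relations A)) (AddSubgroup.closure (relations B))
    (FreeAbelianGroup.map fun s : Gen A ↦ (⟨_, _, _, s.2.2.2.map F⟩ : Gen B))
    (by
      rw [AddSubgroup.closure_le]
      rintro r (⟨X₂, X₁, X₀, s, hs, rfl⟩ | ⟨D, rfl⟩)
      · refine AddSubgroup.subset_closure (Or.inl ⟨_, _, _, s.map F, ?_, ?_⟩)
        · exact ⟨congrArg F.map hs.1, congrArg F.map hs.2⟩
        · exact FreeAbelianGroup.map_of_apply _
      · refine AddSubgroup.subset_closure (Or.inr ⟨D.map F, ?_⟩)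
        simp only [diagramRelation, gen, map_sub, map_add, FreeAbelianGroup.map_of_apply]
        rfl)

theorem map_cls {A : Type u} [Category.{v} A] [Abelian A] {B : Type u'} [Category.{v'} B]
    [Abelian B] (F : A ⥤ B) [F.Additive] [PreservesFiniteLimits F] [PreservesFiniteColimits F]
    {X₂ X₁ X₀ : A} (s : BinarySES X₂ X₁ X₀) : map F (cls s) = cls (s.map F) :=
  congrArg (QuotientAddGroup.mk' (AddSubgroup.closure (relations B)))
    (FreeAbelianGroup.map_of_apply _)

end NenashevK1

/-! ### Length and semisimple objects -/

attribute [local instance] Abelian.hasFiniteBiproducts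

/-- The length of an object of an abelian category: the supremum of the lengths of the chains of
subobjects. The object is of finite length when this is not `⊤`. -/
noncomputable def objLength {A : Type*} [Category* A] [Abelian A] (M : A) : ℕ∞ :=
  Order.height (⊤ : Subobject M)

/-- The semisimple objects (of finite length): finite direct sums of simple objects. -/
def semisimpleObjects (A : Type*) [Category* A] [Abelian A] : ObjectProperty A := fun M ↦
  ∃ (n : ℕ) (S : Fin n → A), (∀ k, Simple (S k)) ∧ Nonempty (M ≅ ⨁ S)

namespace semisimpleObjects

section

variable {A : Type*} [Category* A] [Abelian A]

theorem of_iso {M N : A} (e : M ≅ N) (h : semisimpleObjects A M) : semisimpleObjects A N := by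
  obtain ⟨n, S, hS, ⟨f⟩⟩ := h
  exact ⟨n, S, hS, ⟨e.symm ≪≫ f⟩⟩

theorem of_isZero {M : A} (h : IsZero M) : semisimpleObjects A M := by
  refine ⟨0, fun k ↦ k.elim0, fun k ↦ k.elim0, ⟨h.iso ?_⟩⟩
  rw [IsZero.iff_id_eq_zero]
  exact biproduct.hom_ext _ _ fun k ↦ k.elim0

/-- `⨁ (S₀, …, Sₙ) ≅ S₀ ⊞ ⨁ (S₁, …, Sₙ)`. -/
noncomputable def consIso {n : ℕ} (S : Fin (n + 1) → A) :
    ⨁ S ≅ S 0 ⊞ ⨁ (fun k : Fin n ↦ S k.succ) where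
  hom := biprod.lift (biproduct.π S 0) (biproduct.lift fun k ↦ biproduct.π S k.succ)
  inv := biprod.desc (biproduct.ι S 0) (biproduct.desc fun k ↦ biproduct.ι S k.succ)
  hom_inv_id := by
    simp only [biprod.lift_desc, biproduct.lift_desc]
    rw [← Fin.sum_univ_succ (fun k ↦ biproduct.π S k ≫ biproduct.ι S k), biproduct.total]
  inv_hom_id := by
    ext k k'
    · simp
    · rename_i k
      simp [biproduct.ι_π_ne _ (Fin.succ_ne_zero k).symm]
    · simp [biproduct.ι_π_ne _ (Fin.succ_ne_zero k)]
    · by_cases h : k = k'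
      · subst h
        simp
      · simp [biproduct.ι_π_ne _ h, biproduct.ι_π_ne S (fun h' ↦ h (Fin.succ_injective _ h'))]

theorem simple_biprod {S M : A} (hS : Simple S) (h : semisimpleObjects A M) :
    semisimpleObjects A (S ⊞ M) := by
  obtain ⟨n, T, hT, ⟨e⟩⟩ := h
  refine ⟨n + 1, Fin.cons S T, fun k ↦ Fin.cases hS hT k, ⟨?_⟩⟩
  exact biprod.mapIso (Iso.refl _) e ≪≫ (consIso (Fin.cons S T : Fin (n + 1) → A)).symm

/-- Induction: semisimple objects are obtained from zero objects by adding simple summands. -/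
theorem induct {motive : A → Prop} (zero : ∀ M : A, IsZero M → motive M)
    (add : ∀ S M N : A, Simple S → motive M → Nonempty (N ≅ S ⊞ M) → motive N)
    {M : A} (h : semisimpleObjects A M) : motive M := by
  obtain ⟨n, S, hS, ⟨e⟩⟩ := h
  induction n generalizing M with
  | zero =>
    refine zero M (IsZero.of_iso ?_ e)
    rw [IsZero.iff_id_eq_zero]
    exact biproduct.hom_ext _ _ fun k ↦ k.elim0
  | succ n ih =>
    exact add (S 0) _ M (hS 0) (ih (fun k ↦ S k.succ) (fun k ↦ hS _) (Iso.refl _))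
      ⟨e ≪≫ consIso S⟩

theorem of_mono {N M : A} (h : semisimpleObjects A M) (f : N ⟶ M) [Mono f] :
    semisimpleObjects A N := by
  suffices H : ∀ (N : A) (f : N ⟶ M), Mono f → semisimpleObjects A N from H N f inferInstance
  refine induct (motive := fun M ↦ ∀ (N : A) (f : N ⟶ M), Mono f → semisimpleObjects A N)
    ?_ ?_ h
  · intro M hM N f hf
    exact of_isZero (IsZero.of_mono f hM)
  · rintro S M M' hS ih ⟨e⟩ N f hf
    let f' : N ⟶ S ⊞ M := f ≫ e.hom
    have hf' : Mono f' := inferInstance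
    let g : N ⟶ M := f' ≫ biprod.snd
    let t : kernel g ⟶ S := kernel.ι g ≫ f' ≫ biprod.fst
    have ht : Mono t := by
      refine Preadditive.mono_of_cancel_zero _ fun {G} a ha ↦ ?_
      have h1 : (a ≫ kernel.ι g) ≫ f' = 0 := by
        refine biprod.hom_ext _ _ ?_ ?_
        · simpa [t] using ha
        · have := kernel.condition g
          simp only [g] at this
          simp [g, this]
      rw [← cancel_mono (kernel.ι g), ← cancel_mono f', h1, zero_comp, zero_comp]
    by_cases h0 : t = 0
    · have hk : IsZero (kernel g) := by
        rw [IsZero.iff_id_eq_zero, ← cancel_mono t, h0, comp_zero, comp_zero]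
      have : Mono g := Preadditive.mono_of_kernel_zero (hk.eq_of_src _ _)
      exact ih N g this
    · have hi : IsIso t := isIso_of_mono_of_nonzero h0
      have hI : semisimpleObjects A (Abelian.image g) := ih _ (Abelian.image.ι g) inferInstance
      let T : ShortComplex A := ShortComplex.mk (kernel.ι g) (Abelian.factorThruImage g) (by
        rw [← cancel_mono (Abelian.image.ι g), Category.assoc, Abelian.image.fac,
          kernel.condition, zero_comp])
      have hT : T.Exact := by
        have := ShortComplex.exact_kernel g
        refine (ShortComplex.exact_iff_of_epi_of_isIso_of_mono
          (S₁ := T) (S₂ := ShortComplex.mk (kernel.ι g) g (kernel.condition g))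
          { τ₁ := 𝟙 _
            τ₂ := 𝟙 _
            τ₃ := Abelian.image.ι g
            comm₁₂ := by simp [T]
            comm₂₃ := by simp [T] }).2 this
      have sp : T.Splitting := ShortComplex.Splitting.ofExactOfRetraction T hT
        (f' ≫ biprod.fst ≫ inv t) (by
          have : T.f ≫ f' ≫ biprod.fst ≫ inv t = t ≫ inv t := by
            simp only [T, t, Category.assoc]
          rw [this, IsIso.hom_inv_id]) (inferInstanceAs (Epi (Abelian.factorThruImage g)))
      exact of_iso sp.isoBinaryBiproduct.symm
        (simple_biprod (Simple.of_iso (asIso t)) hI)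

theorem of_epi {M Q : A} (h : semisimpleObjects A M) (f : M ⟶ Q) [Epi f] :
    semisimpleObjects A Q := by
  suffices H : ∀ (Q : A) (f : M ⟶ Q), Epi f → semisimpleObjects A Q from H Q f inferInstance
  refine induct (motive := fun M ↦ ∀ (Q : A) (f : M ⟶ Q), Epi f → semisimpleObjects A Q)
    ?_ ?_ h
  · intro M hM Q f hf
    exact of_isZero (IsZero.of_epi f hM)
  · rintro S M M' hS ih ⟨e⟩ Q f hf
    let f' : S ⊞ M ⟶ Q := e.inv ≫ f
    have hf' : Epi f' := epi_comp _ _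
    let g : M ⟶ Q := biprod.inr ≫ f'
    let t : S ⟶ cokernel g := biprod.inl ≫ f' ≫ cokernel.π g
    have ht : Epi t := by
      refine Preadditive.epi_of_cancel_zero _ fun {G} a ha ↦ ?_
      have h1 : f' ≫ (cokernel.π g ≫ a) = 0 := by
        refine biprod.hom_ext' _ _ ?_ ?_
        · simpa [t] using ha
        · have := cokernel.condition g
          simp only [g, Category.assoc] at this
          rw [← Category.assoc, ← Category.assoc, Category.assoc _ f' _, this]
          simp
      rw [← cancel_epi (cokernel.π g), ← cancel_epi f', h1, comp_zero, comp_zero]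
    by_cases h0 : t = 0
    · have hk : IsZero (cokernel g) := by
        rw [IsZero.iff_id_eq_zero, ← cancel_epi t, h0, zero_comp, zero_comp]
      have : Epi g := Preadditive.epi_of_cokernel_zero (hk.eq_of_tgt _ _)
      exact ih Q g this
    · have hi : IsIso t := isIso_of_epi_of_nonzero h0
      have hI : semisimpleObjects A (Abelian.image g) := ih _ (Abelian.factorThruImage g)
        inferInstance
      let T : ShortComplex A := ShortComplex.mk (Abelian.image.ι g) (cokernel.π g)
        (kernel.condition _)
      have hT : T.Exact := ShortComplex.exact_kernel (cokernel.π g)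
      have sp : T.Splitting := ShortComplex.Splitting.ofExactOfSection T hT
        (inv t ≫ biprod.inl ≫ f') (by
          have : (inv t ≫ biprod.inl ≫ f') ≫ T.g = inv t ≫ t := by simp [T, t]
          rw [this, IsIso.inv_hom_id]) (inferInstanceAs (Mono (Abelian.image.ι g)))
      have hc : Simple (cokernel g) := Simple.of_iso (asIso t).symm
      exact of_iso (biprod.braiding _ _ ≪≫ sp.isoBinaryBiproduct.symm) (simple_biprod hc hI)

theorem biprod_mem {M N : A} (hM : semisimpleObjects A M) (hN : semisimpleObjects A N) :
    semisimpleObjects A (M ⊞ N) := by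
  refine induct (motive := fun M ↦ semisimpleObjects A (M ⊞ N)) ?_ ?_ hM
  · intro M h
    have : Mono (biprod.snd : M ⊞ N ⟶ N) :=
      ⟨fun a b hab ↦ biprod.hom_ext _ _ (h.eq_of_tgt _ _) hab⟩
    exact of_mono hN (biprod.snd : M ⊞ N ⟶ N)
  · rintro S M M' hS ih ⟨e⟩
    exact of_iso ((biprod.associator _ _ _).symm ≪≫ biprod.mapIso e.symm (Iso.refl _))
      (simple_biprod hS ih)

instance : (semisimpleObjects A).IsClosedUnderSubobjects where
  prop_of_mono f _ h := of_mono h f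

instance : (semisimpleObjects A).IsClosedUnderQuotients where
  prop_of_epi f _ h := of_epi h f

instance : (semisimpleObjects A).ContainsZero where
  exists_zero := by
    obtain ⟨Z, hZ⟩ := HasZeroObject.zero (C := A)
    exact ⟨Z, hZ, of_isZero hZ⟩

instance : (semisimpleObjects A).IsClosedUnderFiniteProducts := by
  have : (semisimpleObjects A).IsClosedUnderBinaryProducts := by
    refine ⟨?_⟩
    rintro X ⟨l⟩
    let f : X ⟶ l.diag.obj ⟨WalkingPair.left⟩ ⊞ l.diag.obj ⟨WalkingPair.right⟩ :=
      biprod.lift (l.π.app _) (l.π.app _)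
    have hf : Mono f := by
      refine ⟨fun a b hab ↦ l.isLimit.hom_ext ?_⟩
      rintro ⟨_ | _⟩
      · simpa [f] using congrArg (fun t ↦ t ≫ biprod.fst) hab
      · simpa [f] using congrArg (fun t ↦ t ≫ biprod.snd) hab
    exact of_mono (biprod_mem (l.prop_diag_obj _) (l.prop_diag_obj _)) f
  have : (semisimpleObjects A).IsClosedUnderIsomorphisms := ⟨fun e h ↦ of_iso e h⟩
  exact ObjectProperty.IsClosedUnderFiniteProducts.mk'

instance : PreservesFiniteLimits (semisimpleObjects A).ι := by
  have := (semisimpleObjects A).preservesKernels_ι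
  exact Functor.preservesFiniteLimits_of_preservesKernels _

instance : PreservesFiniteColimits (semisimpleObjects A).ι := by
  have := (semisimpleObjects A).preservesCokernels_ι
  exact Functor.preservesFiniteColimits_of_preservesCokernels _

end

end semisimpleObjects

universe v u

/-- The homomorphism `c : K₁(B) → K₁(A)` induced by the inclusion of the full subcategory `B` of
semisimple objects. -/
noncomputable def semisimpleK1Map (A : Type u) [Category.{v} A] [Abelian A] :
    NenashevK1.K1 (semisimpleObjects A).FullSubcategory →+ NenashevK1.K1 A :=
  NenashevK1.map (semisimpleObjects A).ι

/-! ### The subobjects attached to a binary short acyclic sequence -/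

namespace BinarySES

section

variable {A : Type*} [Category* A] [Abelian A] {M' M M'' : A} (s : BinarySES M' M M'')

/-- `U = i(M') ∩ j(M')`, a subobject of `M`. -/
noncomputable def inter : Subobject M := imageSubobject s.i ⊓ imageSubobject s.j

/-- `i⁻¹(U) ∩ j⁻¹(U)`, a subobject of `M'`. -/
noncomputable def preimageInter : Subobject M' :=
  (Subobject.pullback s.i).obj s.inter ⊓ (Subobject.pullback s.j).obj s.inter

/-- The quotient object `M / (i(M') + j(M'))`. -/
noncomputable def quotSum : A := cokernel (imageSubobject s.i ⊔ imageSubobject s.j).arrow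

/-- The quotient object `M'' / (pj(M') + qi(M'))`. -/
noncomputable def quotCrossSum : A :=
  cokernel (imageSubobject (s.j ≫ s.p) ⊔ imageSubobject (s.i ≫ s.q)).arrow

end

end BinarySES

/-! ### Length in abelian categories -/

section Length

variable {A : Type*} [Category* A] [Abelian A]

/-! Write f(s) for the class of a binary sequence s in the quotient of K₁(A) by the image of c; the
claim is f(s) = 0. Besides obeying Nenashev's relations, f vanishes whenever the top and bottom
sequences are isomorphic. Such a class is a combination of classes of pairs of isomorphisms X ⇉ Y.
Any isomorphism carries socle to socle, so filtering by socles moves these classes into K₁ of the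
semisimple objects (`cls_ofIsoLeft_mem_range`, `invariant`). Everything afterwards uses only these
two properties of f. They are self-dual, so (B) is (A) for the opposite category.

For (A), regard U as the pullback of i and j, with its two embeddings a, b into M'. If M'/a(U) and
M'/b(U) are isomorphic, then a and b form a binary sequence t on U, M', M'/U. The two composites U →
M coincide, so dividing by U gives f(s) + f(t) = f(r), where r starts with M'/U
(`exists_of_cokernel_iso`). When U and M'/U are nonzero, t and r have shorter left terms and
induction applies. If instead U = 0, then M' ⊕ M' embeds in M and f(s) = -f(r) for a sequence r on
M', M'', C, whose middle term is shorter (`exists_of_disjoint`).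

If M' has length at most 2, one of these steps always applies: simple cokernels are isomorphic by a
Jordan–Hölder argument (`nonempty_cokernel_iso`). In length 3, U of length 2 is treated in the same
way. If U is simple and a(U), b(U) meet nontrivially, they coincide, and again the cokernels agree.
What remains is exactly the two excluded configurations. -/

theorem Subobject.pullback_le_pullback_iff_of_epi {X Y : A} (p : X ⟶ Y) [Epi p]
    (P Q : Subobject Y) :
    (Subobject.pullback p).obj P ≤ (Subobject.pullback p).obj Q ↔ P ≤ Q := by
  refine ⟨fun h ↦ ?_, fun h ↦ (Subobject.pullback p).monotone h⟩
  have hP := Subobject.isPullback p P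
  have hQ := Subobject.isPullback p Q
  -- Epimorphisms are stable under base change, so the vanishing of P → Y/Q can be tested on the
  -- preimage of P.
  have : Epi (Subobject.pullbackπ p P) := Abelian.epi_fst_of_isLimit _ _ hP.isLimit
  have h0 : P.arrow ≫ cokernel.π Q.arrow = 0 := by
    rw [← cancel_epi (Subobject.pullbackπ p P), ← Category.assoc, hP.w,
      ← Subobject.ofLE_arrow h, Category.assoc, Category.assoc, ← reassoc_of% hQ.w,
      cokernel.condition]
    simp
  exact Subobject.le_of_comm (Abelian.monoLift Q.arrow P.arrow h0) (Abelian.monoLift_comp _ _ _)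

/-- Chains in `S.X₁` push forward below the kernel of `S.g`, chains in `S.X₃` pull back above it,
and the two concatenate. The descent arguments only need this half of additivity. -/
theorem objLength_add_le {S : ShortComplex A} (h : S.ShortExact) :
    objLength S.X₁ + objLength S.X₃ ≤ objLength S.X₂ := by
  have := h.mono_f
  have := h.epi_g
  let f : Subobject S.X₁ → Subobject S.X₂ := (Subobject.map S.f).obj
  let g : Subobject S.X₃ → Subobject S.X₂ := (Subobject.pullback S.g).obj
  have hf : StrictMono f :=
    (Subobject.map S.f).monotone.strictMono_of_injective (Subobject.map_obj_injective S.f)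
  have hg : StrictMono g := strictMono_of_le_iff_le fun P Q ↦
    (Subobject.pullback_le_pullback_iff_of_epi S.g P Q).symm
  have hfg : f ⊤ ≤ g ⊥ := by
    have hP := Subobject.isPullback S.g ⊥
    change (Subobject.map S.f).obj ⊤ ≤ _
    rw [Subobject.map_top]
    exact Subobject.mk_le_of_comm (hP.lift 0 S.f (by simp)) (hP.lift_snd _ _ _)
  have h1 : objLength S.X₁ ≤ Order.height (g ⊥) :=
    (Order.height_le_height_apply_of_strictMono f hf ⊤).trans (Order.height_mono hfg)
  have h2 : objLength S.X₃ ≤ Order.coheight (g ⊥) := by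
    have e : objLength S.X₃ = Order.coheight (⊥ : Subobject S.X₃) := by
      rw [← WithBot.coe_inj, objLength, Order.height_top_eq_krullDim,
        Order.coheight_bot_eq_krullDim]
    exact e.le.trans (Order.coheight_le_coheight_apply_of_strictMono g hg ⊥)
  refine (add_le_add h1 h2).trans ?_
  rw [← WithBot.coe_le_coe, objLength, Order.height_top_eq_krullDim,
    Order.krullDim_eq_iSup_height_add_coheight_of_nonempty, WithBot.coe_le_coe]
  exact le_iSup (fun a : Subobject S.X₂ ↦ Order.height a + Order.coheight a) (g ⊥)

theorem one_le_objLength {M : A} (h : ¬ IsZero M) : 1 ≤ objLength M := by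
  rw [Order.one_le_iff_ne_zero, objLength, Order.height_ne_zero, isMin_iff_eq_bot]
  intro h'
  exact h ((IsZero.iff_id_eq_zero _).2
    ((Subobject.mk_eq_bot_iff_zero (f := 𝟙 M)).1 ((Subobject.top_eq_id M).symm.trans h')))

theorem ShortExact.of_mono {X Y : A} (f : X ⟶ Y) [Mono f] :
    (ShortComplex.mk f (cokernel.π f) (cokernel.condition f)).ShortExact where
  exact := ShortComplex.exact_cokernel f

theorem objLength_le_of_mono {X Y : A} (f : X ⟶ Y) [Mono f] : objLength X ≤ objLength Y :=
  le_self_add.trans (objLength_add_le (ShortExact.of_mono f))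

theorem objLength_eq_of_iso {X Y : A} (e : X ≅ Y) : objLength X = objLength Y :=
  le_antisymm (objLength_le_of_mono e.hom) (objLength_le_of_mono e.inv)

theorem objLength_add_one_le_left {S : ShortComplex A} (h : S.ShortExact) (h₃ : ¬ IsZero S.X₃) :
    objLength S.X₁ + 1 ≤ objLength S.X₂ :=
  (add_le_add le_rfl (one_le_objLength h₃)).trans (objLength_add_le h)

theorem objLength_add_one_le_right {S : ShortComplex A} (h : S.ShortExact) (h₁ : ¬ IsZero S.X₁) :
    objLength S.X₃ + 1 ≤ objLength S.X₂ := by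
  rw [add_comm]
  exact (add_le_add (one_le_objLength h₁) le_rfl).trans (objLength_add_le h)

theorem exists_mono_of_not_simple {M : A} (h₀ : ¬ IsZero M) (h : ¬ Simple M) :
    ∃ (N : A) (f : N ⟶ M), Mono f ∧ ¬ IsZero N ∧ ¬ IsZero (cokernel f) := by
  by_contra! H
  refine h ⟨fun {N} f hf ↦ ⟨fun _ h0 ↦ ?_, fun h0 ↦ ?_⟩⟩
  · exact h₀ ((IsZero.iff_id_eq_zero _).2 (by rw [← cancel_epi f, h0]; simp))
  · have hN : ¬ IsZero N := fun hN ↦ h0 (hN.eq_of_src _ _)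
    have : Epi f := Preadditive.epi_of_isZero_cokernel f (H N f hf hN)
    exact isIso_of_mono_of_epi f

theorem two_le_objLength {M : A} (h₀ : ¬ IsZero M) (h : ¬ Simple M) : 2 ≤ objLength M := by
  obtain ⟨N, f, _, hN, hc⟩ := exists_mono_of_not_simple h₀ h
  rw [← one_add_one_eq_two]
  exact (add_le_add (one_le_objLength hN) le_rfl).trans
    (objLength_add_one_le_left (ShortExact.of_mono f) hc)

theorem isIso_of_mono_of_objLength_le {X Y : A} (f : X ⟶ Y) [Mono f] (hX : objLength X ≠ ⊤)
    (h : objLength Y ≤ objLength X) : IsIso f := by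
  have : Epi f := by
    refine Preadditive.epi_of_isZero_cokernel f ?_
    by_contra hc
    have h' := (objLength_add_one_le_left (ShortExact.of_mono f) hc).trans h
    exact absurd h' (not_le.2 (ENat.lt_add_one_iff hX |>.2 le_rfl))
  exact isIso_of_mono_of_epi f

open Opposite in
-- Passing to the opposite category reverses the lattice of subobjects, which does not change its
-- Krull dimension.
theorem objLength_op (X : A) : objLength (op X) = objLength X := by
  rw [← WithBot.coe_inj, objLength, objLength, Order.height_top_eq_krullDim,
    Order.height_top_eq_krullDim,
    Order.krullDim_eq_of_orderIso (Abelian.subobjectIsoSubobjectOp X), Order.krullDim_orderDual]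

open Opposite in
theorem Simple.of_op {X : A} (h : Simple (op X)) : Simple X := by
  rw [simple_iff_subobject_isSimpleOrder] at *
  have := isSimpleOrder_iff_isSimpleOrder_orderDual.1 h
  exact (Abelian.subobjectIsoSubobjectOp X).isSimpleOrder

end Length

/-! ### Invariants of binary short acyclic sequences -/

section Sequences

variable {A : Type*} [Category* A] [Abelian A]

theorem shortExact_of_isIso_f {S : ShortComplex A} [IsIso S.f] (h : IsZero S.X₃) :
    S.ShortExact where
  exact := (S.exact_iff_epi (h.eq_of_tgt _ _)).2 inferInstance
  epi_g := ⟨fun _ _ _ ↦ h.eq_of_src _ _⟩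

theorem shortExact_of_isIso_g {S : ShortComplex A} [IsIso S.g] (h : IsZero S.X₁) :
    S.ShortExact where
  exact := (S.exact_iff_mono (h.eq_of_src _ _)).2 inferInstance
  mono_f := ⟨fun _ _ _ ↦ h.eq_of_tgt _ _⟩

/-- The binary sequence `X ⇉ Y ⇉ Z` with `Z = 0` given by two isomorphisms `X ⇉ Y`. -/
def BinarySES.ofIsoLeft {X Y : A} (i j : X ≅ Y) {Z : A} (hZ : IsZero Z) : BinarySES X Y Z where
  i := i.hom
  j := j.hom
  p := 0
  q := 0
  zero_top := comp_zero
  zero_bot := comp_zero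
  exact_top := have : IsIso (ShortComplex.mk i.hom (0 : Y ⟶ Z) comp_zero).f :=
    inferInstanceAs (IsIso i.hom); shortExact_of_isIso_f hZ
  exact_bot := have : IsIso (ShortComplex.mk j.hom (0 : Y ⟶ Z) comp_zero).f :=
    inferInstanceAs (IsIso j.hom); shortExact_of_isIso_f hZ

/-- The binary sequence `Z ⇉ X ⇉ Y` with `Z = 0` given by two isomorphisms `X ⇉ Y`. -/
def BinarySES.ofIsoRight {X Y : A} (p q : X ≅ Y) {Z : A} (hZ : IsZero Z) : BinarySES Z X Y where
  i := 0
  j := 0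
  p := p.hom
  q := q.hom
  zero_top := zero_comp
  zero_bot := zero_comp
  exact_top := have : IsIso (ShortComplex.mk (0 : Z ⟶ X) p.hom zero_comp).g :=
    inferInstanceAs (IsIso p.hom); shortExact_of_isIso_g hZ
  exact_bot := have : IsIso (ShortComplex.mk (0 : Z ⟶ X) q.hom zero_comp).g :=
    inferInstanceAs (IsIso q.hom); shortExact_of_isIso_g hZ

/-- The diagonal binary sequence of a short exact sequence. -/
def BinarySES.diagonal {S : ShortComplex A} (h : S.ShortExact) : BinarySES S.X₁ S.X₂ S.X₃ where
  i := S.f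
  j := S.f
  p := S.g
  q := S.g
  zero_top := S.zero
  zero_bot := S.zero
  exact_top := h
  exact_bot := h

/-- The sequence dual to a binary short acyclic sequence in the opposite category. -/
def BinarySES.unop {X₂ X₁ X₀ : Aᵒᵖ} (s : BinarySES X₂ X₁ X₀) :
    BinarySES X₀.unop X₁.unop X₂.unop where
  i := s.p.unop
  j := s.q.unop
  p := s.i.unop
  q := s.j.unop
  zero_top := by rw [← unop_comp, s.zero_top, unop_zero]
  zero_bot := by rw [← unop_comp, s.zero_bot, unop_zero]
  exact_top := s.exact_top.unop
  exact_bot := s.exact_bot.unop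

open Opposite in
/-- The dual of a binary short acyclic sequence. -/
def BinarySES.op {X₂ X₁ X₀ : A} (s : BinarySES X₂ X₁ X₀) : BinarySES (op X₀) (op X₁) (op X₂) where
  i := s.p.op
  j := s.q.op
  p := s.i.op
  q := s.j.op
  zero_top := by rw [← op_comp, s.zero_top, op_zero]
  zero_bot := by rw [← op_comp, s.zero_bot, op_zero]
  exact_top := s.exact_top.op
  exact_bot := s.exact_bot.op

/-- The dual of a `3 × 3` diagram in the opposite category. -/
def NenashevDiagram.unop (D : NenashevDiagram Aᵒᵖ) : NenashevDiagram A where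
  row' := D.row''.unop
  row := D.row.unop
  row'' := D.row'.unop
  col₂ := D.col₀.unop
  col₁ := D.col₁.unop
  col₀ := D.col₂.unop
  top_comm₁ := (congrArg Quiver.Hom.unop D.top_comm₄).symm
  top_comm₂ := (congrArg Quiver.Hom.unop D.top_comm₃).symm
  top_comm₃ := (congrArg Quiver.Hom.unop D.top_comm₂).symm
  top_comm₄ := (congrArg Quiver.Hom.unop D.top_comm₁).symm
  bot_comm₁ := (congrArg Quiver.Hom.unop D.bot_comm₄).symm
  bot_comm₂ := (congrArg Quiver.Hom.unop D.bot_comm₃).symm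
  bot_comm₃ := (congrArg Quiver.Hom.unop D.bot_comm₂).symm
  bot_comm₄ := (congrArg Quiver.Hom.unop D.bot_comm₁).symm

end Sequences

/-- A function on binary short acyclic sequences that satisfies Nenashev's relations and vanishes
whenever the top and the bottom sequence are isomorphic. -/
structure NenashevInvariant (A : Type*) [Category* A] [Abelian A] (G : Type*) [AddCommGroup G] where
  toFun : ∀ {X₂ X₁ X₀ : A}, BinarySES X₂ X₁ X₀ → G
  diagram : ∀ D : NenashevDiagram A, toFun D.col₀ - toFun D.col₁ + toFun D.col₂ =
    toFun D.row' - toFun D.row + toFun D.row''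
  eq_zero_of_iso : ∀ {X₂ X₁ X₀ : A} (s : BinarySES X₂ X₁ X₀) (α : X₂ ≅ X₂) (β : X₁ ≅ X₁)
    (γ : X₀ ≅ X₀), α.hom ≫ s.j = s.i ≫ β.hom → β.hom ≫ s.q = s.p ≫ γ.hom → toFun s = 0

namespace NenashevInvariant

variable {A : Type*} [Category* A] [Abelian A] {G : Type*} [AddCommGroup G]

/-- The dual invariant. -/
def op (f : NenashevInvariant A G) : NenashevInvariant Aᵒᵖ G where
  toFun s := f.toFun s.unop
  diagram D := by
    have := f.diagram D.unop
    simp only [NenashevDiagram.unop] at this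
    rw [sub_add_eq_add_sub, add_comm, ← sub_add_eq_add_sub, this]
    abel
  eq_zero_of_iso s α β γ h₁ h₂ := f.eq_zero_of_iso s.unop γ.symm.unop β.symm.unop α.symm.unop
    (Quiver.Hom.op_inj (by
      change s.q ≫ γ.inv = β.inv ≫ s.p
      rw [Iso.comp_inv_eq, Category.assoc, ← h₂, Iso.inv_hom_id_assoc]))
    (Quiver.Hom.op_inj (by
      change s.j ≫ β.inv = α.inv ≫ s.i
      rw [Iso.comp_inv_eq, Category.assoc, ← h₁, Iso.inv_hom_id_assoc]))

variable (f : NenashevInvariant A G)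

theorem eq_zero_of_isDiagonal {X₂ X₁ X₀ : A} (s : BinarySES X₂ X₁ X₀) (h : s.IsDiagonal) :
    f.toFun s = 0 :=
  f.eq_zero_of_iso s (Iso.refl _) (Iso.refl _) (Iso.refl _) (by simp [h.1]) (by simp [h.2])

/-- Here i and j are isomorphisms, and i j⁻¹ on the left term identifies the top sequence with the
bottom one. -/
theorem eq_zero_of_isZero_right {X₂ X₁ X₀ : A} (s : BinarySES X₂ X₁ X₀) (h : IsZero X₀) :
    f.toFun s = 0 := by
  have h₁ : IsIso s.i := s.exact_top.isIso_f_iff.2 h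
  have h₂ : IsIso s.j := s.exact_bot.isIso_f_iff.2 h
  exact f.eq_zero_of_iso s (asIso s.i ≪≫ (asIso s.j).symm) (Iso.refl _) (Iso.refl _)
    (by simp) (h.eq_of_tgt _ _)

/-- Exactness of `V/U → M/U → M/V` for a filtration `U ⊆ V ⊆ M`. -/
theorem _root_.exists_shortExact_quotient {U V W M N Q : A} {a : U ⟶ V} {b : V ⟶ W} {w : a ≫ b = 0}
    (h : (ShortComplex.mk a b w).ShortExact) {i : V ⟶ M} {p : M ⟶ Q} {w' : i ≫ p = 0}
    (h' : (ShortComplex.mk i p w').ShortExact) {u : U ⟶ M} {r : M ⟶ N} {w'' : u ≫ r = 0}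
    (h'' : (ShortComplex.mk u r w'').ShortExact) (hu : a ≫ i = u) :
    ∃ (i' : W ⟶ N) (p' : N ⟶ Q) (z : i' ≫ p' = 0), (ShortComplex.mk i' p' z).ShortExact ∧
      i ≫ r = b ≫ i' ∧ p = r ≫ p' := by
  subst hu
  have := h.epi_g
  have := h'.mono_f
  have := h'.epi_g
  have := h''.epi_g
  dsimp at *
  have hi' : a ≫ i ≫ r = 0 := by rw [← Category.assoc, w'']
  let i' : W ⟶ N := h.exact.desc (i ≫ r) hi'
  let p' : N ⟶ Q := h''.exact.desc p (by simp [w'])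
  have hb : b ≫ i' = i ≫ r := h.exact.g_desc _ _
  have hr : r ≫ p' = p := h''.exact.g_desc _ _
  have z : i' ≫ p' = 0 := by
    rw [← cancel_epi b, reassoc_of% hb, hr, w', comp_zero]
  have hm : Mono i' := by
    refine Preadditive.mono_of_cancel_zero _ fun {T} t ht ↦ ?_
    obtain ⟨T', π, _, x, hx⟩ := surjective_up_to_refinements_of_epi b t
    have : (x ≫ i) ≫ r = 0 := by
      rw [Category.assoc, ← hb, ← reassoc_of% hx, ht, comp_zero]
    obtain ⟨T'', π', _, y, hy⟩ := h''.exact.exact_up_to_refinements (x ≫ i) this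
    have hy' : π' ≫ x = y ≫ a := by
      rw [← cancel_mono i]; simpa using hy
    rw [← cancel_epi π, ← cancel_epi π', hx, reassoc_of% hy', w]
    simp
  have he : Epi p' := epi_of_epi_fac hr
  refine ⟨i', p', z, ⟨?_⟩, hb.symm, hr.symm⟩
  rw [ShortComplex.exact_iff_exact_up_to_refinements]
  intro T t ht
  obtain ⟨T', π, _, x, hx⟩ := surjective_up_to_refinements_of_epi r t
  have : x ≫ p = 0 := by
    rw [← hr, ← reassoc_of% hx]
    dsimp at ht
    rw [ht, comp_zero]
  obtain ⟨T'', π', _, y, hy⟩ := h'.exact.exact_up_to_refinements x this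
  refine ⟨T'', π' ≫ π, epi_comp _ _, y ≫ b, ?_⟩
  dsimp at hy ⊢
  rw [Category.assoc, Category.assoc, hx, hb, reassoc_of% hy]

/-- This is the binary form of the third isomorphism theorem for U ⊆ V ⊆ M, with `r` given by V/U,
M/U, M/V. It is the source of every relation used in the descent. -/
theorem exists_quotient {U V W M N Q : A} (a : BinarySES U V W) (s : BinarySES V M Q)
    (u : BinarySES U M N) (hi : a.i ≫ s.i = u.i) (hj : a.j ≫ s.j = u.j) :
    ∃ r : BinarySES W N Q, f.toFun s + f.toFun a = f.toFun u + f.toFun r := by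
  obtain ⟨i', p', z, e, h₁, h₂⟩ := exists_shortExact_quotient a.exact_top s.exact_top u.exact_top hi
  obtain ⟨j', q', z', e', h₁', h₂'⟩ :=
    exists_shortExact_quotient a.exact_bot s.exact_bot u.exact_bot hj
  let r : BinarySES W N Q := ⟨i', j', p', q', z, z', e, e'⟩
  refine ⟨r, ?_⟩
  obtain ⟨Z, hZ⟩ := HasZeroObject.zero (C := A)
  -- The rows are U = U → 0, then `s`, then `r`; the columns are `a`, `u` and 0 → Q = Q. The padding
  -- is diagonal and contributes nothing.
  let D : NenashevDiagram A :=
    { row' := BinarySES.ofIsoLeft (Iso.refl U) (Iso.refl U) hZ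
      row := s
      row'' := r
      col₂ := a
      col₁ := u
      col₀ := BinarySES.ofIsoRight (Iso.refl Q) (Iso.refl Q) hZ
      top_comm₁ := by simp [BinarySES.ofIsoLeft, hi]
      bot_comm₁ := by simp [BinarySES.ofIsoLeft, hj]
      top_comm₂ := by simp [BinarySES.ofIsoLeft, BinarySES.ofIsoRight, ← hi, s.zero_top]
      bot_comm₂ := by simp [BinarySES.ofIsoLeft, BinarySES.ofIsoRight, ← hj, s.zero_bot]
      top_comm₃ := h₁
      bot_comm₃ := h₁'
      top_comm₄ := by simpa [BinarySES.ofIsoRight] using h₂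
      bot_comm₄ := by simpa [BinarySES.ofIsoRight] using h₂' }
  have h := f.diagram D
  have e₁ : f.toFun D.row' = 0 := f.eq_zero_of_isDiagonal _ ⟨rfl, rfl⟩
  have e₂ : f.toFun D.col₀ = 0 := f.eq_zero_of_isDiagonal _ ⟨rfl, rfl⟩
  rw [e₁, e₂] at h
  change 0 - f.toFun u + f.toFun a = 0 - f.toFun s + f.toFun r at h
  have h' : f.toFun a = f.toFun u - f.toFun s + f.toFun r := by
    rw [zero_sub, zero_sub, neg_add_eq_sub, sub_eq_iff_eq_add] at h
    rw [h]; abel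
  rw [h']; abel

end NenashevInvariant

/-! ### The socle, and automorphisms -/

section Socle

variable {A : Type*} [Category* A] [Abelian A]

theorem finiteDimensionalOrder_subobject {M : A} (h : objLength M ≠ ⊤) :
    FiniteDimensionalOrder (Subobject M) := by
  rw [Order.finiteDimensionalOrder_iff_krullDim_ne_bot_and_top, ← Order.height_top_eq_krullDim]
  exact ⟨WithBot.coe_ne_bot, fun h' ↦ h (WithBot.coe_injective h')⟩

theorem wellFoundedLT_subobject {M : A} (h : objLength M ≠ ⊤) : WellFoundedLT (Subobject M) := by
  have := finiteDimensionalOrder_subobject h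
  exact ⟨(SetRel.IsWellFounded.of_finiteDimensional
    (r := {(a, b) : Subobject M × Subobject M | a < b}))⟩

theorem wellFoundedGT_subobject {M : A} (h : objLength M ≠ ⊤) : WellFoundedGT (Subobject M) := by
  have := finiteDimensionalOrder_subobject h
  exact ⟨(SetRel.IsWellFounded.inv_of_finiteDimensional
    (r := {(a, b) : Subobject M × Subobject M | a < b}))⟩

theorem semisimpleObjects.of_simple {S : A} (hS : Simple S) : semisimpleObjects A S := by
  obtain ⟨Z, hZ⟩ := HasZeroObject.zero (C := A)
  have : Mono (biprod.inl : S ⟶ S ⊞ Z) := inferInstance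
  exact semisimpleObjects.of_mono
    (semisimpleObjects.simple_biprod hS (semisimpleObjects.of_isZero hZ)) (biprod.inl : S ⟶ S ⊞ Z)

/-- A maximal semisimple subobject absorbs every semisimple one, since sums of semisimple subobjects
are semisimple. This universal property makes isomorphisms respect the socle. -/
theorem exists_socle {M : A} (h : objLength M ≠ ⊤) :
    ∃ (T : A) (t : T ⟶ M), Mono t ∧ semisimpleObjects A T ∧ (¬ IsZero M → ¬ IsZero T) ∧
      ∀ (N : A) (n : N ⟶ M), semisimpleObjects A N → ∃ g : N ⟶ T, g ≫ t = n := by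
  have hgt := wellFoundedGT_subobject h
  have hlt := wellFoundedLT_subobject h
  obtain ⟨P, hP, hmax⟩ := hgt.wf.has_min {P : Subobject M | semisimpleObjects A (P : A)}
    ⟨⊥, semisimpleObjects.of_isZero ((isZero_zero A).of_iso Subobject.botCoeIsoZero)⟩
  have hfac : ∀ (N : A) (n : N ⟶ M), semisimpleObjects A N → ∃ g : N ⟶ (P : A), g ≫ P.arrow = n := by
    intro N n hN
    let d : (P : A) ⊞ N ⟶ M := biprod.desc P.arrow n
    let ι := Abelian.image.ι d
    have hI : semisimpleObjects A (Abelian.image d) :=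
      semisimpleObjects.of_epi (semisimpleObjects.biprod_mem hP hN) (Abelian.factorThruImage d)
    have hle : P ≤ Subobject.mk ι :=
      Subobject.le_mk_of_comm (biprod.inl ≫ Abelian.factorThruImage d) (by
        rw [Category.assoc, Abelian.image.fac, biprod.inl_desc])
    -- The image of P ⊕ N is semisimple and contains P, so maximality forces equality.
    have heq : P = Subobject.mk ι := by
      refine eq_of_le_of_not_lt hle fun hlt ↦ hmax _ ?_ hlt
      exact semisimpleObjects.of_iso (Subobject.underlyingIso ι).symm hI
    refine ⟨biprod.inr ≫ Abelian.factorThruImage d ≫ Subobject.ofMkLE ι P heq.ge, ?_⟩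
    rw [Category.assoc, Category.assoc, Subobject.ofMkLE_arrow, Abelian.image.fac, biprod.inr_desc]
  refine ⟨P, P.arrow, inferInstance, hP, fun hM hZ ↦ ?_, hfac⟩
  have : IsArtinianObject M := ⟨hlt⟩
  obtain ⟨Y, hY⟩ := exists_simple_subobject hM
  obtain ⟨g, hg⟩ := hfac Y Y.arrow (semisimpleObjects.of_simple hY)
  refine Simple.not_isZero (Y : A) ((IsZero.iff_id_eq_zero _).2 ?_)
  rw [← cancel_mono Y.arrow, ← hg, hZ.eq_of_tgt g 0]
  simp

end Socle

/-! ### Dévissage of pairs of isomorphisms along the socle. -/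

namespace NenashevK1

section

variable {A : Type u} [Category.{v} A] [Abelian A]

theorem cls_diagonal {X₂ X₁ X₀ : A} (s : BinarySES X₂ X₁ X₀) (h : s.IsDiagonal) : cls s = 0 :=
  (QuotientAddGroup.eq_zero_iff _).2
    (AddSubgroup.subset_closure (Or.inl ⟨_, _, _, s, h, rfl⟩))

theorem cls_diagram (D : NenashevDiagram A) :
    cls D.col₀ - cls D.col₁ + cls D.col₂ = cls D.row' - cls D.row + cls D.row'' := by
  rw [← sub_eq_zero]
  exact (QuotientAddGroup.eq_zero_iff _).2
    (AddSubgroup.subset_closure (Or.inr ⟨D, rfl⟩))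

theorem shortExact_homMk {X₂ X₁ X₀ : (semisimpleObjects A).FullSubcategory}
    {i : X₂.obj ⟶ X₁.obj} {p : X₁.obj ⟶ X₀.obj} {w : i ≫ p = 0}
    (h : (ShortComplex.mk i p w).ShortExact) :
    (ShortComplex.mk (ObjectProperty.homMk i : X₂ ⟶ X₁) (ObjectProperty.homMk p : X₁ ⟶ X₀)
      (ObjectProperty.hom_ext _ w)).ShortExact := by
  have hm : Mono i := h.mono_f
  have he : Epi p := h.epi_g
  refine @ShortComplex.ShortExact.mk _ _ _ _ ?_ ?_ ?_
  · exact (ShortComplex.exact_map_iff_of_faithful _ (semisimpleObjects A).ι).1 h.exact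
  · exact (semisimpleObjects A).ι.mono_of_mono_map hm
  · exact (semisimpleObjects A).ι.epi_of_epi_map he

theorem cls_mem_range_of_semisimple {X₂ X₁ X₀ : A} (s : BinarySES X₂ X₁ X₀)
    (h₂ : semisimpleObjects A X₂) (h₁ : semisimpleObjects A X₁) (h₀ : semisimpleObjects A X₀) :
    cls s ∈ (semisimpleK1Map A).range := by
  let s' : BinarySES (A := (semisimpleObjects A).FullSubcategory) ⟨X₂, h₂⟩ ⟨X₁, h₁⟩ ⟨X₀, h₀⟩ :=
    { i := ObjectProperty.homMk s.i
      j := ObjectProperty.homMk s.j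
      p := ObjectProperty.homMk s.p
      q := ObjectProperty.homMk s.q
      zero_top := ObjectProperty.hom_ext _ s.zero_top
      zero_bot := ObjectProperty.hom_ext _ s.zero_bot
      exact_top := shortExact_homMk s.exact_top
      exact_bot := shortExact_homMk s.exact_bot }
  exact ⟨cls s', map_cls (semisimpleObjects A).ι s'⟩

/-- Both isomorphisms restrict to the socles and descend to the quotients by them. The socle part
comes from K₁ of the semisimple objects, and the quotient part is handled by induction on length. -/
theorem cls_ofIsoLeft_mem_range (hfin : ∀ X : A, objLength X ≠ ⊤) {X Y Z : A} (i j : X ≅ Y)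
    (hZ : IsZero Z) : cls (BinarySES.ofIsoLeft i j hZ) ∈ (semisimpleK1Map A).range := by
  induction hn : objLength X using WellFoundedLT.induction generalizing X Y with
  | ind n ih =>
  by_cases hX : IsZero X
  · have hij : i = j := Iso.ext (hX.eq_of_src _ _)
    rw [cls_diagonal _ ⟨congrArg Iso.hom hij, rfl⟩]
    exact zero_mem _
  obtain ⟨T, t, _, hT, hT0, ht⟩ := exists_socle (hfin X)
  obtain ⟨T', t', _, hT', -, ht'⟩ := exists_socle (hfin Y)
  -- The universal property of the socle is applied to the isomorphism and to its inverse.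
  have key : ∀ i : X ≅ Y, ∃ e : T ≅ T', e.hom ≫ t' = t ≫ i.hom := by
    intro i
    obtain ⟨g, hg⟩ := ht' T (t ≫ i.hom) hT
    obtain ⟨g', hg'⟩ := ht T' (t' ≫ i.inv) hT'
    refine ⟨⟨g, g', ?_, ?_⟩, hg⟩
    · rw [← cancel_mono t, Category.assoc, hg', ← Category.assoc, hg]; simp
    · rw [← cancel_mono t', Category.assoc, hg, ← Category.assoc, hg']; simp
  obtain ⟨e₁, he₁⟩ := key i
  obtain ⟨e₂, he₂⟩ := key j
  have se := ShortExact.of_mono t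
  have se' := ShortExact.of_mono t'
  let c (i : X ≅ Y) (e : T ≅ T') (h : e.hom ≫ t' = t ≫ i.hom) : cokernel t ≅ cokernel t' :=
    cokernel.mapIso _ _ e i h.symm
  let D : NenashevDiagram A :=
    { row' := BinarySES.ofIsoLeft e₁ e₂ hZ
      row := BinarySES.ofIsoLeft i j hZ
      row'' := BinarySES.ofIsoLeft (c i e₁ he₁) (c j e₂ he₂) hZ
      col₂ := BinarySES.diagonal se
      col₁ := BinarySES.diagonal se'
      col₀ := BinarySES.ofIsoLeft (Iso.refl Z) (Iso.refl Z) hZ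
      top_comm₁ := he₁
      bot_comm₁ := he₂
      top_comm₂ := hZ.eq_of_tgt _ _
      bot_comm₂ := hZ.eq_of_tgt _ _
      top_comm₃ := by simp [BinarySES.diagonal, BinarySES.ofIsoLeft, c]
      bot_comm₃ := by simp [BinarySES.diagonal, BinarySES.ofIsoLeft, c]
      top_comm₄ := hZ.eq_of_tgt _ _
      bot_comm₄ := hZ.eq_of_tgt _ _ }
  have h := cls_diagram D
  rw [cls_diagonal D.col₀ ⟨rfl, rfl⟩, cls_diagonal D.col₁ ⟨rfl, rfl⟩,
    cls_diagonal D.col₂ ⟨rfl, rfl⟩, sub_zero, add_zero, eq_comm, sub_add_eq_add_sub, sub_eq_zero] at h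
  change cls D.row ∈ _
  rw [← h]
  refine add_mem (cls_mem_range_of_semisimple _ hT hT' (semisimpleObjects.of_isZero hZ))
    (ih _ ?_ _ _ rfl)
  rw [← hn, ← ENat.add_one_le_iff]
  · exact objLength_add_one_le_right se (hT0 hX)
  · exact hfin _

/-- The class of a binary short acyclic sequence modulo the image of `K₁` of the semisimple
objects. -/
noncomputable def invariant (hfin : ∀ X : A, objLength X ≠ ⊤) :
    NenashevInvariant A (K1 A ⧸ (semisimpleK1Map A).range) where
  toFun s := QuotientAddGroup.mk' _ (cls s)
  diagram D := by
    simpa only [map_add, map_sub] using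
      congrArg (QuotientAddGroup.mk' (semisimpleK1Map A).range) (cls_diagram D)
  eq_zero_of_iso {X₂ X₁ X₀} s α β γ h₁ h₂ := by
    refine (QuotientAddGroup.eq_zero_iff _).2 ?_
    obtain ⟨Z, hZ⟩ := HasZeroObject.zero (C := A)
    -- The top of each column is an identity and the bottom is α, β or γ, so the diagram compares
    -- `s` with the diagonal sequence on its top half. The error terms are pairs of isomorphisms.
    let D : NenashevDiagram A :=
      { row' := BinarySES.diagonal s.exact_top
        row := s
        row'' := BinarySES.ofIsoLeft (Iso.refl Z) (Iso.refl Z) hZ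
        col₂ := BinarySES.ofIsoLeft (Iso.refl X₂) α hZ
        col₁ := BinarySES.ofIsoLeft (Iso.refl X₁) β hZ
        col₀ := BinarySES.ofIsoLeft (Iso.refl X₀) γ hZ
        top_comm₁ := by simp [BinarySES.diagonal, BinarySES.ofIsoLeft]
        bot_comm₁ := h₁.symm
        top_comm₂ := by simp [BinarySES.diagonal, BinarySES.ofIsoLeft]
        bot_comm₂ := h₂.symm
        top_comm₃ := hZ.eq_of_tgt _ _
        bot_comm₃ := hZ.eq_of_tgt _ _
        top_comm₄ := hZ.eq_of_tgt _ _
        bot_comm₄ := hZ.eq_of_tgt _ _ }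
    have h := cls_diagram D
    rw [cls_diagonal D.row' ⟨rfl, rfl⟩, cls_diagonal D.row'' ⟨rfl, rfl⟩, zero_sub, add_zero,
      eq_comm, neg_eq_iff_eq_neg] at h
    change cls D.row ∈ _
    rw [h]
    exact neg_mem (add_mem (sub_mem (cls_ofIsoLeft_mem_range hfin _ _ hZ)
      (cls_ofIsoLeft_mem_range hfin _ _ hZ)) (cls_ofIsoLeft_mem_range hfin _ _ hZ))

end

end NenashevK1

/-! ### Vanishing for sequences with a short left term -/

section Cokernel

variable {A : Type*} [Category* A] [Abelian A]

theorem nonempty_cokernel_iso_of_fac {U M : A} (a b : U ⟶ M) [Simple (cokernel a)]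
    (hb : ¬ IsZero (cokernel b)) (g : U ⟶ U) (hg : g ≫ b = a) :
    Nonempty (cokernel a ≅ cokernel b) := by
  let φ : cokernel a ⟶ cokernel b := cokernel.desc a (cokernel.π b) (by simp [← hg])
  have hφ : cokernel.π a ≫ φ = cokernel.π b := cokernel.π_desc _ _ _
  have : Epi φ := epi_of_epi_fac hφ
  have : IsIso φ := isIso_of_epi_of_nonzero fun h ↦ hb ((IsZero.iff_id_eq_zero _).2 (by
    rw [← cancel_epi φ, h]; simp))
  exact ⟨asIso φ⟩

/-- Two simple quotients of an object of finite length with isomorphic kernels are isomorphic. -/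
theorem nonempty_cokernel_iso (hfin : ∀ X : A, objLength X ≠ ⊤) {U M : A} (a b : U ⟶ M)
    [Mono a] [Mono b] [Simple (cokernel a)] [Simple (cokernel b)] :
    Nonempty (cokernel a ≅ cokernel b) := by
  induction hn : objLength M using WellFoundedLT.induction generalizing U M with
  | ind n ih =>
  -- With V = a(U) ∩ b(U), the two copies of U/V embed in the simple objects M/b(U) and M/a(U), so
  -- each is zero or everything. If one is zero, one embedding factors through the other; otherwise
  -- induction applies to the two maps V → U.
  have sq := IsPullback.of_hasPullback a b
  have m₁ : Mono (cokernel.map (pullback.fst a b) b (pullback.snd a b) a sq.w) :=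
    Abelian.mono_cokernel_map_of_isPullback sq
  have m₂ : Mono (cokernel.map (pullback.snd a b) a (pullback.fst a b) b sq.w.symm) :=
    Abelian.mono_cokernel_map_of_isPullback sq.flip
  by_cases h₁ : IsZero (cokernel (pullback.fst a b))
  · have : Epi (pullback.fst a b) := Preadditive.epi_of_isZero_cokernel _ h₁
    have : IsIso (pullback.fst a b) := isIso_of_mono_of_epi _
    refine nonempty_cokernel_iso_of_fac a b (Simple.not_isZero _)
      (inv (pullback.fst a b) ≫ pullback.snd a b) ?_
    rw [Category.assoc, ← pullback.condition, IsIso.inv_hom_id_assoc]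
  by_cases h₂ : IsZero (cokernel (pullback.snd a b))
  · have : Epi (pullback.snd a b) := Preadditive.epi_of_isZero_cokernel _ h₂
    have : IsIso (pullback.snd a b) := isIso_of_mono_of_epi _
    refine (nonempty_cokernel_iso_of_fac b a (Simple.not_isZero _)
      (inv (pullback.snd a b) ≫ pullback.fst a b) ?_).map Iso.symm
    rw [Category.assoc, pullback.condition, IsIso.inv_hom_id_assoc]
  have i₁ : IsIso (cokernel.map (pullback.fst a b) b (pullback.snd a b) a sq.w) :=
    isIso_of_mono_of_nonzero fun h ↦ h₁ ((IsZero.iff_id_eq_zero _).2 (by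
      rw [← cancel_mono (cokernel.map (pullback.fst a b) b (pullback.snd a b) a sq.w), h]; simp))
  have i₂ : IsIso (cokernel.map (pullback.snd a b) a (pullback.fst a b) b sq.w.symm) :=
    isIso_of_mono_of_nonzero fun h ↦ h₂ ((IsZero.iff_id_eq_zero _).2 (by
      rw [← cancel_mono (cokernel.map (pullback.snd a b) a (pullback.fst a b) b sq.w.symm), h]
      simp))
  have e₁ := asIso (cokernel.map (pullback.fst a b) b (pullback.snd a b) a sq.w)
  have e₂ := asIso (cokernel.map (pullback.snd a b) a (pullback.fst a b) b sq.w.symm)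
  have : Simple (cokernel (pullback.fst a b)) := Simple.of_iso e₁
  have : Simple (cokernel (pullback.snd a b)) := Simple.of_iso e₂
  have hU : objLength U < n := by
    rw [← hn, ← ENat.add_one_le_iff (hfin U)]
    exact objLength_add_one_le_left (ShortExact.of_mono a) (Simple.not_isZero _)
  obtain ⟨e⟩ := ih _ hU (pullback.fst a b) (pullback.snd a b) rfl
  exact ⟨e₂.symm ≪≫ e.symm ≪≫ e₁⟩

end Cokernel

/-! ### Descent on the intersection U and the short cases. -/

namespace NenashevInvariant

variable {A : Type*} [Category* A] [Abelian A] {G : Type*} [AddCommGroup G]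
  (f : NenashevInvariant A G)

theorem eq_zero_of_isZero_left {X₂ X₁ X₀ : A} (s : BinarySES X₂ X₁ X₀) (h : IsZero X₂) :
    f.toFun s = 0 :=
  f.op.eq_zero_of_isZero_right s.op h.op

/-- `θ` is what allows `a` and `b` to share a third term, making them a binary sequence. By `w` the
induced sequence from U to M can be taken diagonal, so its term drops out. -/
theorem exists_of_cokernel_iso {M' M M'' U : A} (s : BinarySES M' M M'') (a b : U ⟶ M')
    [Mono a] [Mono b] (w : a ≫ s.i = b ≫ s.j) (θ : cokernel a ≅ cokernel b) :
    ∃ (t : BinarySES U M' (cokernel a)) (r : BinarySES (cokernel a) (cokernel (a ≫ s.i)) M''),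
      f.toFun s + f.toFun t = f.toFun r := by
  have : Mono s.i := s.exact_top.mono_f
  have z : b ≫ cokernel.π b ≫ θ.inv = 0 := by simp
  have hb : (ShortComplex.mk b (cokernel.π b ≫ θ.inv) z).ShortExact :=
    ShortComplex.shortExact_of_iso
      (S₁ := ShortComplex.mk b (cokernel.π b) (cokernel.condition b))
      (ShortComplex.isoMk (Iso.refl _) (Iso.refl _) θ.symm (by simp) (by simp))
      (ShortExact.of_mono b)
  let t : BinarySES U M' (cokernel a) :=
    ⟨a, b, cokernel.π a, cokernel.π b ≫ θ.inv, cokernel.condition a, z, ShortExact.of_mono a, hb⟩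
  let u : BinarySES U M (cokernel (a ≫ s.i)) :=
    BinarySES.diagonal (ShortExact.of_mono (a ≫ s.i))
  obtain ⟨r, hr⟩ := f.exists_quotient t s u rfl w.symm
  refine ⟨t, r, ?_⟩
  rw [hr, f.eq_zero_of_isDiagonal u ⟨rfl, rfl⟩, zero_add]

/-- The binary sequence `X ⇉ X ⊞ X ⇉ X` given by the two inclusions. -/
noncomputable def _root_.BinarySES.swap (X : A) : BinarySES X (X ⊞ X) X where
  i := biprod.inl
  j := biprod.inr
  p := biprod.snd
  q := biprod.fst
  zero_top := biprod.inl_snd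
  zero_bot := biprod.inr_fst
  exact_top := (ShortComplex.Splitting.ofHasBinaryBiproduct X X).shortExact
  exact_bot := ShortComplex.shortExact_of_iso
    (S₁ := ShortComplex.mk (biprod.inl : X ⟶ X ⊞ X) (biprod.snd : X ⊞ X ⟶ X) biprod.inl_snd)
    (ShortComplex.isoMk (Iso.refl _) (biprod.braiding X X) (Iso.refl _)
      (by dsimp; ext <;> simp) (by simp))
    (ShortComplex.Splitting.ofHasBinaryBiproduct X X).shortExact

theorem swap_eq_zero (X : A) : f.toFun (BinarySES.swap X) = 0 :=
  f.eq_zero_of_iso _ (Iso.refl _) (biprod.braiding X X) (Iso.refl _)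
    (by dsimp [BinarySES.swap]; ext <;> simp) (by simp [BinarySES.swap])

/-- Trivial intersection means M' ⊕ M' embeds in M. Apply `exists_quotient` to the first or second
summand inside M' ⊕ M' inside M: the swap sequence and the diagonal one vanish, leaving `s` and the
quotient sequence. -/
theorem exists_of_disjoint {M' M M'' U : A} (s : BinarySES M' M M'') {a b : U ⟶ M'}
    (sq : IsPullback a b s.i s.j) (hU : IsZero U) :
    ∃ (C : A) (r : BinarySES M' M'' C), f.toFun s = - f.toFun r := by
  have : Mono (biprod.desc s.i s.j) := by
    refine Preadditive.mono_of_cancel_zero _ fun {T} x hx ↦ ?_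
    have h : (x ≫ biprod.fst) ≫ s.i = (-x ≫ biprod.snd) ≫ s.j := by
      rw [biprod.desc_eq, Preadditive.comp_add] at hx
      rw [Preadditive.neg_comp, Category.assoc, Category.assoc]
      exact eq_neg_of_add_eq_zero_left hx
    refine biprod.hom_ext _ _ ?_ ?_
    · rw [← sq.lift_fst _ _ h, hU.eq_of_tgt (sq.lift _ _ h) 0, zero_comp, zero_comp]
    · rw [zero_comp, ← neg_eq_zero, ← Preadditive.neg_comp]
      have := sq.lift_snd _ _ h
      rw [hU.eq_of_tgt (sq.lift _ _ h) 0, zero_comp] at this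
      rw [Preadditive.neg_comp, ← this]
  obtain ⟨r, hr⟩ := f.exists_quotient (BinarySES.swap M')
    (BinarySES.diagonal (ShortExact.of_mono (biprod.desc s.i s.j))) s
    (biprod.inl_desc _ _) (biprod.inr_desc _ _)
  refine ⟨_, r, ?_⟩
  rw [f.swap_eq_zero, f.eq_zero_of_isDiagonal _ ⟨rfl, rfl⟩, add_zero] at hr
  exact eq_neg_of_add_eq_zero_left hr.symm

theorem isZero_cokernel_of_isZero_cokernel (hfin : ∀ X : A, objLength X ≠ ⊤) {U M : A}
    (a b : U ⟶ M) [Mono a] [Mono b] (h : IsZero (cokernel a)) : IsZero (cokernel b) := by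
  have : Epi a := Preadditive.epi_of_isZero_cokernel _ h
  have : IsIso a := isIso_of_mono_of_epi a
  have : IsIso b := isIso_of_mono_of_objLength_le b (hfin U) (objLength_eq_of_iso (asIso a)).ge
  exact isZero_cokernel_of_epi b

theorem eq_zero_of_isZero_cokernel (hfin : ∀ X : A, objLength X ≠ ⊤) {M' M M'' U : A}
    (s : BinarySES M' M M'') (a b : U ⟶ M') [Mono a] [Mono b] (w : a ≫ s.i = b ≫ s.j)
    (h : IsZero (cokernel a)) : f.toFun s = 0 := by
  obtain ⟨t, r, e⟩ := f.exists_of_cokernel_iso s a b w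
    (h.iso (isZero_cokernel_of_isZero_cokernel hfin a b h))
  rwa [f.eq_zero_of_isZero_right t h, f.eq_zero_of_isZero_left r h, add_zero] at e

/-- This is the inductive step: if U and M'/U are both nonzero, each has length at most n, and these
are the left terms of the two auxiliary sequences. -/
theorem eq_zero_of_cokernel_iso (hfin : ∀ X : A, objLength X ≠ ⊤) {n : ℕ∞}
    (hn : ∀ {M' M M'' : A} (s : BinarySES M' M M''), objLength M' ≤ n → f.toFun s = 0)
    {M' M M'' U : A} (s : BinarySES M' M M'') (a b : U ⟶ M') [Mono a] [Mono b]
    (w : a ≫ s.i = b ≫ s.j) (hM' : objLength M' ≤ n + 1) (hU : ¬ IsZero U)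
    (θ : cokernel a ≅ cokernel b) : f.toFun s = 0 := by
  by_cases h : IsZero (cokernel a)
  · exact f.eq_zero_of_isZero_cokernel hfin s a b w h
  obtain ⟨t, r, e⟩ := f.exists_of_cokernel_iso s a b w θ
  have h₁ := (objLength_add_one_le_left (ShortExact.of_mono a) h).trans hM'
  have h₂ := (objLength_add_one_le_right (ShortExact.of_mono a) hU).trans hM'
  rw [ENat.add_le_add_iff_right ENat.one_ne_top] at h₁ h₂
  rwa [hn t h₁, hn r h₂, add_zero] at e

theorem eq_zero_of_length_le_two (hfin : ∀ X : A, objLength X ≠ ⊤) {M' M M'' : A}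
    (s : BinarySES M' M M'') (hM' : objLength M' ≤ 2) : f.toFun s = 0 := by
  suffices H : ∀ n : ℕ, n ≤ 2 → ∀ {M' M M'' : A} (s : BinarySES M' M M''), objLength M' ≤ n →
      f.toFun s = 0 from H 2 le_rfl s hM'
  intro n
  induction n with
  | zero =>
    intro _ M' M M'' s h
    refine f.eq_zero_of_isZero_left s (by_contra fun h' ↦ ?_)
    exact absurd ((one_le_objLength h').trans h) (by norm_num)
  | succ n ihn =>
  intro hn M' M M'' s h
  have hn' : ((n + 1 : ℕ) : ℕ∞) ≤ 2 := by exact_mod_cast hn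
  -- The case U = 0 keeps M' and replaces M by M'', so a second induction, on the length of M, is
  -- nested inside the one on M'.
  induction hl : objLength M using WellFoundedLT.induction generalizing M M'' with
  | ind l ih =>
  have : Mono s.i := s.exact_top.mono_f
  have : Mono s.j := s.exact_bot.mono_f
  have sq := IsPullback.of_hasPullback s.i s.j
  by_cases hM : IsZero M'
  · exact f.eq_zero_of_isZero_left s hM
  by_cases hU : IsZero (pullback s.i s.j)
  · obtain ⟨C, r, hr⟩ := f.exists_of_disjoint s sq hU
    rw [hr, ih (objLength M'') ?_ r rfl, neg_zero]
    rw [← hl, ← ENat.add_one_le_iff (hfin _)]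
    exact objLength_add_one_le_right s.exact_top hM
  by_cases ha : IsZero (cokernel (pullback.fst s.i s.j))
  · exact f.eq_zero_of_isZero_cokernel hfin s _ _ sq.w ha
  have hb : ¬ IsZero (cokernel (pullback.snd s.i s.j)) := fun hb ↦
    ha (isZero_cokernel_of_isZero_cokernel hfin _ _ hb)
  have hs : ∀ a : pullback s.i s.j ⟶ M', Mono a → ¬ IsZero (cokernel a) →
      Simple (cokernel a) := by
    intro a _ ha
    by_contra hs
    -- A nonsimple cokernel would give M' length at least 1 + 2.
    exact absurd (((add_le_add (one_le_objLength hU) (two_le_objLength ha hs)).trans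
      (objLength_add_le (ShortExact.of_mono a))).trans (h.trans hn')) (by norm_num)
  have := hs _ inferInstance ha
  have := hs _ inferInstance hb
  obtain ⟨θ⟩ := nonempty_cokernel_iso hfin (pullback.fst s.i s.j) (pullback.snd s.i s.j)
  exact f.eq_zero_of_cokernel_iso hfin (ihn (by omega)) s _ _ sq.w (by exact_mod_cast h) hU θ

/-- In length 3 everything reduces to an isomorphism between the cokernels of `a` and `b`. Stating
the exceptions through a pullback square and test maps makes them transport directly to the opposite
category. -/
theorem eq_zero_of_length_le_three (hfin : ∀ X : A, objLength X ≠ ⊤) {M' M M'' U : A}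
    (s : BinarySES M' M M'') {a b : U ⟶ M'} (sq : IsPullback a b s.i s.j)
    (hM' : objLength M' ≤ 3)
    (h₁ : ¬ (objLength M' = 3 ∧ Simple U ∧
      ∀ {W : A} (x y : W ⟶ U), x ≫ a = y ≫ b → x = 0))
    (h₀ : ¬ (objLength M' = 3 ∧ IsZero U)) : f.toFun s = 0 := by
  have : Mono s.i := s.exact_top.mono_f
  have : Mono s.j := s.exact_bot.mono_f
  have hma : Mono a := MorphismProperty.of_isPullback (P := .monomorphisms A) sq.flip ‹Mono s.j›
  have hmb : Mono b := MorphismProperty.of_isPullback (P := .monomorphisms A) sq ‹Mono s.i›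
  by_cases h2 : objLength M' ≤ 2
  · exact f.eq_zero_of_length_le_two hfin s h2
  have h3 : objLength M' = 3 := le_antisymm hM' (Order.add_one_le_of_lt (not_le.1 h2))
  have hU : ¬ IsZero U := fun hU ↦ h₀ ⟨h3, hU⟩
  by_cases ha : IsZero (cokernel a)
  · exact f.eq_zero_of_isZero_cokernel hfin s _ _ sq.w ha
  have hb : ¬ IsZero (cokernel b) := fun hb ↦ ha (isZero_cokernel_of_isZero_cokernel hfin _ _ hb)
  suffices h : Nonempty (cokernel a ≅ cokernel b) by
    obtain ⟨θ⟩ := h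
    exact f.eq_zero_of_cokernel_iso hfin (f.eq_zero_of_length_le_two hfin) s _ _ sq.w hM' hU θ
  by_cases hS : Simple U
  · have hd : ¬ ∀ {W : A} (x y : W ⟶ U), x ≫ a = y ≫ b → x = 0 := fun hd ↦ h₁ ⟨h3, hS, hd⟩
    push Not at hd
    obtain ⟨W, x, y, hxy, hx⟩ := hd
    -- The intersection of a(U) and b(U) is nonzero and U is simple, so a factors as g followed by
    -- b. The monomorphism g is an automorphism because U has finite length.
    have hfst : IsIso (pullback.fst a b) := isIso_of_mono_of_nonzero fun h ↦ hx (by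
      rw [← pullback.lift_fst x y hxy, h, comp_zero])
    let g : U ⟶ U := inv (pullback.fst a b) ≫ pullback.snd a b
    have hg : IsIso g := isIso_of_mono_of_objLength_le g (hfin U) le_rfl
    exact ⟨cokernel.mapIso a b (asIso g) (Iso.refl _) (by simp [g, pullback.condition])⟩
  -- Now U has length at least 2, leaving room only for a simple cokernel.
  · have hs : ∀ a : U ⟶ M', Mono a → ¬ IsZero (cokernel a) → Simple (cokernel a) := by
      intro a _ ha
      by_contra hs
      exact absurd (((add_le_add (two_le_objLength hU hS) (two_le_objLength ha hs)).trans
        (objLength_add_le (ShortExact.of_mono a))).trans hM') (by norm_num)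
    have := hs a hma ha
    have := hs b hmb hb
    exact nonempty_cokernel_iso hfin a b

end NenashevInvariant

/-! ### The subobjects attached to a binary short acyclic sequence -/

namespace BinarySES

variable {A : Type*} [Category* A] [Abelian A] {M' M M'' : A} (s : BinarySES M' M M'')

theorem exists_isPullback_inter :
    ∃ a b : (s.inter : A) ⟶ M', a ≫ s.i = s.inter.arrow ∧ b ≫ s.j = s.inter.arrow ∧
      IsPullback a b s.i s.j := by
  have : Mono s.i := s.exact_top.mono_f
  have : Mono s.j := s.exact_bot.mono_f
  have hinter : s.inter = Subobject.mk s.i ⊓ Subobject.mk s.j := by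
    rw [inter, imageSubobject_mono, imageSubobject_mono]
  have hi : s.inter ≤ Subobject.mk s.i := hinter.trans_le inf_le_left
  have hj : s.inter ≤ Subobject.mk s.j := hinter.trans_le inf_le_right
  have ha := Subobject.ofLEMk_comp hi
  have hb := Subobject.ofLEMk_comp hj
  refine ⟨_, _, ha, hb, ⟨⟨ha.trans hb.symm⟩, ⟨PullbackCone.IsLimit.mk _
    (fun c ↦ s.inter.factorThru (c.fst ≫ s.i) ?_) ?_ ?_ ?_⟩⟩⟩
  · rw [hinter, Subobject.inf_factors]
    exact ⟨(Subobject.mk_factors_iff _ _).2 ⟨c.fst, rfl⟩,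
      (Subobject.mk_factors_iff _ _).2 ⟨c.snd, c.condition.symm⟩⟩
  · intro c
    rw [← cancel_mono s.i, Category.assoc, ha, Subobject.factorThru_arrow]
  · intro c
    rw [← cancel_mono s.j, Category.assoc, hb, Subobject.factorThru_arrow, c.condition]
  · intro c m h₁ _
    rw [← cancel_mono s.inter.arrow, Subobject.factorThru_arrow, ← ha, ← Category.assoc, h₁]

/-- The inclusion of i⁻¹(U) ∩ j⁻¹(U) factors through both `a` and `b`, so it is an instance of the
test maps in the hypothesis. -/
theorem preimageInter_eq_bot {a b : (s.inter : A) ⟶ M'} (ha : a ≫ s.i = s.inter.arrow)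
    (hb : b ≫ s.j = s.inter.arrow)
    (h : ∀ {W : A} (x y : W ⟶ (s.inter : A)), x ≫ a = y ≫ b → x = 0) :
    s.preimageInter = ⊥ := by
  have : Mono s.i := s.exact_top.mono_f
  have : Mono s.j := s.exact_bot.mono_f
  let k := s.preimageInter.arrow
  have key : ∀ (g : M' ⟶ M) [Mono g] (c : (s.inter : A) ⟶ M'), c ≫ g = s.inter.arrow →
      s.preimageInter ≤ (Subobject.pullback g).obj s.inter → ∃ x, x ≫ c = k := by
    intro g _ c hc hle
    refine ⟨Subobject.ofLE _ _ hle ≫ Subobject.pullbackπ g s.inter, ?_⟩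
    rw [← cancel_mono g, Category.assoc, Category.assoc, hc, (Subobject.isPullback g s.inter).w,
      Subobject.ofLE_arrow_assoc]
  obtain ⟨x, hx⟩ := key s.i a ha inf_le_left
  obtain ⟨y, hy⟩ := key s.j b hb inf_le_right
  rw [← Subobject.mk_arrow s.preimageInter, Subobject.mk_eq_bot_iff_zero]
  change k = 0
  rw [← hx, h x y (hx.trans hy.symm), zero_comp]

theorem _root_.imageSubobject_sup_arrow_comp_eq_zero_iff {X Y Z W : A} (f : X ⟶ Z) (g : Y ⟶ Z)
    (m : Z ⟶ W) :
    (imageSubobject f ⊔ imageSubobject g).arrow ≫ m = 0 ↔ f ≫ m = 0 ∧ g ≫ m = 0 := by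
  have h₁ : ∀ {X : A} (f : X ⟶ Z) (S : Subobject Z), imageSubobject f ≤ S → S.arrow ≫ m = 0 →
      f ≫ m = 0 := by
    intro X f S hle h
    rw [← imageSubobject_arrow_comp f, ← Subobject.ofLE_arrow hle, Category.assoc, Category.assoc,
      h, comp_zero, comp_zero]
  have h₂ : ∀ {X : A} (f : X ⟶ Z), f ≫ m = 0 → imageSubobject f ≤ kernelSubobject m := by
    intro X f h
    refine le_kernelSubobject _ _ ?_
    rw [← cancel_epi (factorThruImageSubobject f), imageSubobject_arrow_comp_assoc, h, comp_zero]
  refine ⟨fun h ↦ ⟨h₁ f _ le_sup_left h, h₁ g _ le_sup_right h⟩, fun ⟨hf, hg⟩ ↦ ?_⟩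
  rw [← Subobject.ofLE_arrow (sup_le (h₂ f hf) (h₂ g hg)), Category.assoc,
    kernelSubobject_arrow_comp, comp_zero]

theorem exists_quotSum_π :
    ∃ π : M ⟶ s.quotSum, Epi π ∧ s.i ≫ π = 0 ∧ s.j ≫ π = 0 ∧
      ∀ {W : A} (m : M ⟶ W), s.i ≫ m = 0 → s.j ≫ m = 0 → ∃ n : s.quotSum ⟶ W, π ≫ n = m := by
  obtain ⟨hi, hj⟩ := (imageSubobject_sup_arrow_comp_eq_zero_iff s.i s.j _).1
    (cokernel.condition (imageSubobject s.i ⊔ imageSubobject s.j).arrow)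
  exact ⟨cokernel.π _, inferInstanceAs (Epi (cokernel.π _)), hi, hj, fun m h₁ h₂ ↦
    ⟨cokernel.desc _ m ((imageSubobject_sup_arrow_comp_eq_zero_iff s.i s.j _).2 ⟨h₁, h₂⟩),
      cokernel.π_desc _ _ _⟩⟩

theorem exists_quotCrossSum_π :
    ∃ π : M'' ⟶ s.quotCrossSum, Epi π ∧ s.j ≫ s.p ≫ π = 0 ∧ s.i ≫ s.q ≫ π = 0 := by
  obtain ⟨h₁, h₂⟩ := (imageSubobject_sup_arrow_comp_eq_zero_iff (s.j ≫ s.p) (s.i ≫ s.q) _).1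
    (cokernel.condition (imageSubobject (s.j ≫ s.p) ⊔ imageSubobject (s.i ≫ s.q)).arrow)
  exact ⟨cokernel.π _, inferInstanceAs (Epi (cokernel.π _)), (Category.assoc _ _ _).symm.trans h₁,
    (Category.assoc _ _ _).symm.trans h₂⟩

/-- This is the dual of the description of U as a pullback, together with the dual of the triviality
test for i⁻¹(U) ∩ j⁻¹(U). -/
theorem exists_isPushout_quotSum :
    ∃ a b : M'' ⟶ s.quotSum, IsPushout s.p s.q a b ∧
      ((∀ {W : A} (x y : s.quotSum ⟶ W), a ≫ x = b ≫ y → x = 0) → IsZero s.quotCrossSum) := by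
  have hp : Epi s.p := s.exact_top.epi_g
  have hq : Epi s.q := s.exact_bot.epi_g
  obtain ⟨π, _, hi, hj, hdesc⟩ := s.exists_quotSum_π
  obtain ⟨a, ha⟩ : ∃ a : M'' ⟶ s.quotSum, s.p ≫ a = π := ⟨_, s.exact_top.exact.g_desc π hi⟩
  obtain ⟨b, hb⟩ : ∃ b : M'' ⟶ s.quotSum, s.q ≫ b = π := ⟨_, s.exact_bot.exact.g_desc π hj⟩
  refine ⟨a, b, ?_, fun h ↦ ?_⟩
  · have hc (c : PushoutCocone s.p s.q) : ∃ n : s.quotSum ⟶ c.pt, π ≫ n = s.p ≫ c.inl := by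
      refine hdesc _ ?_ ?_
      · rw [← Category.assoc, s.zero_top, zero_comp]
      · rw [c.condition, ← Category.assoc, s.zero_bot, zero_comp]
    choose n hn using hc
    refine ⟨⟨ha.trans hb.symm⟩, ⟨PushoutCocone.IsColimit.mk _ n ?_ ?_ ?_⟩⟩
    · intro c
      rw [← cancel_epi s.p, ← Category.assoc, ha, hn]
    · intro c
      rw [← cancel_epi s.q, ← Category.assoc, hb, hn, c.condition]
    · intro c m h₁ _
      rw [← cancel_epi π, hn, ← h₁, ← Category.assoc, ha]
  -- Both pρ and qρ kill i(M') and j(M'), so ρ factors through `a` and through `b`; the hypothesis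
  -- then forces the epimorphism ρ to vanish.
  · obtain ⟨ρ, _, h₁, h₂⟩ := s.exists_quotCrossSum_π
    obtain ⟨x, hx⟩ := hdesc (s.p ≫ ρ) (by rw [← Category.assoc, s.zero_top, zero_comp]) h₁
    obtain ⟨y, hy⟩ := hdesc (s.q ≫ ρ) h₂ (by rw [← Category.assoc, s.zero_bot, zero_comp])
    have hx' : a ≫ x = ρ := by rw [← cancel_epi s.p, ← Category.assoc, ha, hx]
    have hy' : b ≫ y = ρ := by rw [← cancel_epi s.q, ← Category.assoc, hb, hy]
    rw [h x y (hx'.trans hy'.symm), comp_zero] at hx'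
    exact (IsZero.iff_id_eq_zero _).2 (by rw [← cancel_epi ρ, ← hx', zero_comp, zero_comp])

end BinarySES

theorem mainTheorem2 {A : Type u} [Category.{v} A] [Abelian A]
    (hfin : ∀ X : A, objLength X ≠ ⊤)
    {M' M M'' : A} (s : BinarySES M' M M'') :
    (objLength M' ≤ 3 →
      ¬ (objLength M' = 3 ∧ Simple (s.inter : A) ∧ s.preimageInter = ⊥) →
      ¬ (objLength M' = 3 ∧ s.inter = ⊥) →
      NenashevK1.cls s ∈ (semisimpleK1Map A).range) ∧
    (objLength M'' ≤ 3 →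
      ¬ (objLength M'' = 3 ∧ Simple s.quotSum ∧ IsZero s.quotCrossSum) →
      ¬ (objLength M'' = 3 ∧ IsZero s.quotSum) →
      NenashevK1.cls s ∈ (semisimpleK1Map A).range) := by
  have key : ∀ {M' M M'' : A} (s : BinarySES M' M M''),
      (NenashevK1.invariant hfin).toFun s = 0 → NenashevK1.cls s ∈ (semisimpleK1Map A).range :=
    fun s h ↦ (QuotientAddGroup.eq_zero_iff _).1 h
  refine ⟨fun hM' h₁ h₀ ↦ key s ?_, fun hM'' h₁ h₀ ↦ key s ?_⟩
  · obtain ⟨a, b, ha, hb, sq⟩ := s.exists_isPullback_inter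
    refine (NenashevK1.invariant hfin).eq_zero_of_length_le_three hfin s sq hM' ?_ ?_
    · exact fun ⟨h3, hS, hd⟩ ↦ h₁ ⟨h3, hS, s.preimageInter_eq_bot ha hb hd⟩
    · rintro ⟨h3, hZ⟩
      refine h₀ ⟨h3, ?_⟩
      rw [← Subobject.mk_arrow s.inter, Subobject.mk_eq_bot_iff_zero]
      exact hZ.eq_of_src _ _
  · obtain ⟨a, b, sq, hab⟩ := s.exists_isPushout_quotSum
    -- The dual invariant still takes values in the quotient of K₁(A), so no comparison with K₁ of
    -- the opposite category is needed.
    refine (NenashevK1.invariant hfin).op.eq_zero_of_length_le_three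
      (fun X ↦ (objLength_op X.unop).trans_ne (hfin _)) s.op sq.op.flip
      ((objLength_op M'').trans_le hM'') ?_ ?_
    · rintro ⟨h3, hS, hd⟩
      refine h₁ ⟨(objLength_op M'').symm.trans h3, Simple.of_op hS,
        hab fun x y hxy ↦ ?_⟩
      exact Quiver.Hom.op_inj (hd x.op y.op (congrArg Quiver.Hom.op hxy))
    · exact fun ⟨h3, hZ⟩ ↦ h₀ ⟨(objLength_op M'').symm.trans h3, hZ.unop⟩
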